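/- Let $F$ be a field of characteristic different from $2$ and let $A$ be a Novikov algebra over $F$, i.e. a (not necessarily associative or unital) $F$-algebra satisfying $(x,y,z)=(y,x,z)$ and $(xy)z=(xz)y$ for all $x,y,z\in A$, where $(x,y,z)=(xy)z-x(yz)$. Put $A^{(0)_L}=A$ and let $A^{(n+1)_L}=[A^{(n)_L},A^{(n)_L}]$ be the subspace spanned by all commutators $xy-yx$ with $x,y\in A^{(n)_L}$. Suppose that $A$ is Lie-solvable, i.e. $A^{(n)_L}=0$ for some $n\ge 0$, and semiprime, i.e. $A$ has no nonzero two-sided ideal $I$ with $I^2=0$. Then $A$ is a subdirect product of integral domains: there are a (possibly empty) family $(B_i)_{i}$ of nonzero associative and commutative (not necessarily unital) $F$-algebras without nonzero zero divisors, and an injective homomorphism of $F$-algebras $\varphi\colon A\to\prod_i B_i$ whose composition with each projection $\prod_j B_j\to B_i$ is surjective. -/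

import Mathlib

universe u v

namespace Novikov

/-- The Novikov identities `(x, y, z) = (y, x, z)` and `(xy)z = (xz)y`, where
`(x, y, z) = (xy)z - x(yz)` is the associator. -/
structure IsNovikov (A : Type*) [NonUnitalNonAssocRing A] : Prop where
  left_symm : ∀ x y z : A, associator x y z = associator y x z
  right_comm : ∀ x y z : A, (x * y) * z = (x * z) * y

section Defs

variable (F : Type*) [Field F] (A : Type*) [NonUnitalNonAssocRing A] [Module F A]

/-- The Lie-solvable powers of `A`: the zeroth one is `A`, and the `(n+1)`-st one is the subspace
spanned by all commutators of elements of the `n`-th one. -/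
def lieSolvablePower : ℕ → Submodule F A
  | 0 => ⊤
  | n + 1 => Submodule.span F
      {z | ∃ x ∈ lieSolvablePower n, ∃ y ∈ lieSolvablePower n, z = x * y - y * x}

/-- `A` is Lie-solvable if some Lie-solvable power of `A` is zero. -/
def IsLieSolvable : Prop :=
  ∃ n : ℕ, lieSolvablePower F A n = ⊥

variable {F A} in
/-- A two-sided ideal of the algebra `A`: a subspace closed under left and right multiplication
by elements of `A`. -/
def IsIdeal (I : Submodule F A) : Prop :=
  ∀ a : A, ∀ x ∈ I, a * x ∈ I ∧ x * a ∈ I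

/-- `A` is semiprime if it has no nonzero ideal with zero multiplication. -/
def IsSemiprime : Prop :=
  ∀ I : Submodule F A, IsIdeal I → (∀ x ∈ I, ∀ y ∈ I, x * y = 0) → I = ⊥

end Defs

/-- An integral domain in the sense of not necessarily unital algebras: a nonzero associative and
commutative algebra without nonzero zero divisors. -/
structure IsIntegralDomain (B : Type*) [NonUnitalNonAssocRing B] : Prop where
  mul_assoc : ∀ x y z : B, (x * y) * z = x * (y * z)
  mul_comm : ∀ x y : B, x * y = y * x
  eq_zero_or_eq_zero : ∀ x y : B, x * y = 0 → x = 0 ∨ y = 0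
  exists_ne_zero : ∃ x : B, x ≠ 0

/-- An `F`-algebra homomorphism `φ` from `A` to a direct product of algebras represents `A` as a
subdirect product of the factors: `φ` is injective and maps onto each factor. -/
def IsSubdirect {F A ι : Type*} [Field F] [NonUnitalNonAssocRing A] [Module F A]
    {B : ι → Type*} [∀ i, NonUnitalNonAssocRing (B i)] [∀ i, Module F (B i)]
    (φ : A →ₙₐ[F] (∀ i, B i)) : Prop :=
  Function.Injective φ ∧ ∀ i, Function.Surjective fun a : A => φ a i

end Novikov

namespace Novikov

/-! ### Commutativity of Lie-solvable semiprime Novikov algebras. -/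

section Ideals

variable {F : Type*} [Field F] {A : Type*} [NonUnitalNonAssocRing A] [Module F A]

/-! Lie-solvability and semiprimeness together force commutativity. As `2` is invertible, every
Lie-solvable power is an ideal (`isIdeal_lieSolvablePower`). If `A^(n+2) = 0`, then `D = A^(n+1)` is
a commutative ideal, hence central (`commute_of_mem_commutative_ideal`). The identity `2[x,y]z =
[xz,y] + [x,yz]` then gives `D * D = 0`, so `D = 0`; descending, `A^(1) = 0`. A commutative Novikov
algebra is associative, and semiprime then means reduced. The primes of its unitization therefore
separate the points of `A`, and the images of `A` in the quotients are the factors. -/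

theorem IsNovikov.mul_sub_mul (hA : IsNovikov A) (x y z : A) :
    (x * y) * z - x * (y * z) = (y * x) * z - y * (x * z) :=
  hA.left_symm x y z

theorem IsNovikov.two_smul_commutator_mul (hA : IsNovikov A) (x y z : A) :
    (2 : F) • ((x * y - y * x) * z) =
      ((x * z) * y - y * (x * z)) + (x * (y * z) - (y * z) * x) := by
  have h := hA.mul_sub_mul x y z
  have h₁ := hA.right_comm x y z
  have h₂ := hA.right_comm y x z
  rw [two_smul, sub_mul, ← h₁, ← h₂]
  have h₃ : x * (y * z) = (x * y) * z - (y * x) * z + y * (x * z) := by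
    rw [sub_add, ← h]; abel
  rw [h₃]
  abel

variable [IsScalarTower F A A]

/-- The annihilator of `D` inside `D` is an ideal of square zero; for left multiples, `(az)y = (ay)z
= z(ay) = 0`. -/
theorem eq_zero_of_mul_commutative_ideal_eq_zero (hA : IsNovikov A) (hsemi : IsSemiprime F A)
    {D : Submodule F A} (hD : IsIdeal D) (hcomm : ∀ x ∈ D, ∀ y ∈ D, x * y = y * x)
    {x : A} (hx : x ∈ D) (hxD : ∀ y ∈ D, x * y = 0) : x = 0 := by
  let I : Submodule F A :=
    { carrier := {z | z ∈ D ∧ ∀ y ∈ D, z * y = 0}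
      zero_mem' := ⟨zero_mem D, fun _ _ => zero_mul _⟩
      add_mem' := fun ha hb =>
        ⟨add_mem ha.1 hb.1, fun y hy => by rw [add_mul, ha.2 y hy, hb.2 y hy, add_zero]⟩
      smul_mem' := fun c z hz =>
        ⟨D.smul_mem c hz.1, fun y hy => by rw [smul_mul_assoc, hz.2 y hy, smul_zero]⟩ }
  have hI : IsIdeal I := fun a z hz =>
    ⟨⟨(hD a z hz.1).1, fun y hy => by
        rw [hA.right_comm, hcomm _ (hD a y hy).1 z hz.1, hz.2 _ (hD a y hy).1]⟩,
      ⟨(hD a z hz.1).2, fun y hy => by rw [hA.right_comm, hz.2 y hy, zero_mul]⟩⟩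
  have hbot : I = ⊥ := hsemi I hI fun u hu w hw => hu.2 w hw.1
  have hxI : x ∈ I := ⟨hx, hxD⟩
  rwa [hbot, Submodule.mem_bot] at hxI

/-- In a semiprime Novikov algebra every commutative ideal is central. -/
theorem commute_of_mem_commutative_ideal (hA : IsNovikov A) (hsemi : IsSemiprime F A)
    {D : Submodule F A} (hD : IsIdeal D) (hcomm : ∀ x ∈ D, ∀ y ∈ D, x * y = y * x)
    (a : A) {x : A} (hx : x ∈ D) : a * x = x * a := by
  -- Write `d e = ae - ea`. On `D` both `d(e)y = e d(y)` and the Leibniz rule hold, so `d(yz) = 2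
  -- d(y)z`. Hence `d(e)(yz) = e d(yz) = 2 d(e)yz`, which forces `d(e)yz = 0`. Cancelling `z` and
  -- then `y` by the annihilator lemma gives `d(e) = 0`.
  have hE : ∀ e ∈ D, a * e - e * a ∈ D := fun e he => sub_mem (hD a e he).1 (hD a e he).2
  have assoc : ∀ u ∈ D, ∀ v ∈ D, ∀ w ∈ D, (u * v) * w = u * (v * w) := fun u hu v hv w hw => by
    rw [hcomm u hu v hv, hA.right_comm, hcomm _ (hD v w hw).1 u hu]
  have swap : ∀ e ∈ D, ∀ y ∈ D, (a * e - e * a) * y = e * (a * y - y * a) := fun e he y hy => by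
    have h : (e * a) * y = (y * a) * e := by
      rw [hA.right_comm e a y, hcomm e he y hy, hA.right_comm]
    rw [sub_mul, h, hA.right_comm, ← sub_mul, hcomm _ (hE y hy) e he]
  have leibniz : ∀ e ∈ D, ∀ y ∈ D,
      a * (e * y) - (e * y) * a = (a * e - e * a) * y + e * (a * y - y * a) := fun e he y hy => by
    have h₁ : a * (e * y) = (a * e) * y - (e * a) * y + e * (a * y) := by
      rw [sub_add, ← hA.mul_sub_mul a e y]; abel
    have h₂ : e * (y * a) = (e * y) * a := by
      rw [← hcomm _ (hD a y hy).2 e he, hA.right_comm, hcomm y hy e he]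
    rw [h₁, mul_sub, sub_mul, h₂, hA.right_comm e a y]
    abel
  have double : ∀ e ∈ D, ∀ y ∈ D,
      a * (e * y) - (e * y) * a = (a * e - e * a) * y + (a * e - e * a) * y :=
    fun e he y hy => by rw [leibniz e he y hy, ← swap e he y hy]
  have triple : ∀ e ∈ D, ∀ y ∈ D, ∀ z ∈ D, ((a * e - e * a) * y) * z = 0 := by
    intro e he y hy z hz
    have h := swap e he (y * z) (hD z y hy).2
    rw [double y hy z hz, mul_add, ← assoc e he _ (hE y hy) z hz, ← swap e he y hy,
      ← assoc _ (hE e he) y hy z hz] at h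
    simpa using h
  rw [← sub_eq_zero]
  refine eq_zero_of_mul_commutative_ideal_eq_zero hA hsemi hD hcomm (hE x hx) fun y hy => ?_
  exact eq_zero_of_mul_commutative_ideal_eq_zero hA hsemi hD hcomm
    (hD y _ (hE x hx)).2 (triple x hx y hy)

variable [SMulCommClass F A A]

theorem isIdeal_lieSolvablePower (hF : (2 : F) ≠ 0) (hA : IsNovikov A) (n : ℕ) :
    IsIdeal (lieSolvablePower F A n) := by
  induction n with
  | zero => exact fun _ _ _ => ⟨Submodule.mem_top, Submodule.mem_top⟩
  | succ n ih =>
    have comm_mem : ∀ x ∈ lieSolvablePower F A n, ∀ y ∈ lieSolvablePower F A n,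
        x * y - y * x ∈ lieSolvablePower F A (n + 1) :=
      fun x hx y hy => Submodule.subset_span ⟨x, hx, y, hy, rfl⟩
    have le : lieSolvablePower F A (n + 1) ≤ lieSolvablePower F A n := by
      refine Submodule.span_le.2 ?_
      rintro _ ⟨x, hx, y, -, rfl⟩
      exact sub_mem (ih y x hx).2 (ih y x hx).1
    have right : ∀ a : A, ∀ z ∈ lieSolvablePower F A (n + 1),
        z * a ∈ lieSolvablePower F A (n + 1) := by
      intro a z hz
      refine Submodule.span_induction (p := fun z _ => z * a ∈ lieSolvablePower F A (n + 1))
        ?_ (by simp) (fun x y _ _ hx hy => by rw [add_mul]; exact add_mem hx hy)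
        (fun c x _ hx => by rw [smul_mul_assoc]; exact Submodule.smul_mem _ c hx) hz
      rintro _ ⟨x, hx, y, hy, rfl⟩
      rw [← Submodule.smul_mem_iff _ hF, hA.two_smul_commutator_mul]
      exact add_mem (comm_mem _ (ih a x hx).2 _ hy) (comm_mem _ hx _ (ih a y hy).2)
    suffices left : ∀ a : A, ∀ z ∈ lieSolvablePower F A (n + 1),
        a * z ∈ lieSolvablePower F A (n + 1) from fun a z hz => ⟨left a z hz, right a z hz⟩
    intro a z hz
    refine Submodule.span_induction (p := fun z _ => a * z ∈ lieSolvablePower F A (n + 1))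
      ?_ (by simp) (fun x y _ _ hx hy => by rw [mul_add]; exact add_mem hx hy)
      (fun c x _ hx => by rw [mul_smul_comm]; exact Submodule.smul_mem _ c hx) hz
    rintro _ ⟨x, hx, y, hy, rfl⟩
    -- This is the Jacobi identity for the commutator, which follows from left symmetry; the term
    -- `[x,y]a` is covered by closure on the right.
    have key : a * (x * y - y * x) = ((a * x - x * a) * y - y * (a * x - x * a))
        + (x * (a * y - y * a) - (a * y - y * a) * x) + (x * y - y * x) * a := by
      have h₁ := hA.mul_sub_mul a x y
      have h₂ := hA.mul_sub_mul a y x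
      have h₃ := hA.mul_sub_mul x y a
      have e₁ : a * (x * y) = (a * x) * y - (x * a) * y + x * (a * y) := by
        rw [sub_add, ← h₁]; abel
      have e₂ : a * (y * x) = (a * y) * x - (y * a) * x + y * (a * x) := by
        rw [sub_add, ← h₂]; abel
      have e₃ : x * (y * a) = (x * y) * a - (y * x) * a + y * (x * a) := by
        rw [sub_add, ← h₃]; abel
      simp only [mul_sub, sub_mul, e₁, e₂, e₃]
      abel
    rw [key]
    have hc : ∀ w ∈ lieSolvablePower F A n, a * w - w * a ∈ lieSolvablePower F A n :=
      fun w hw => sub_mem (ih a w hw).1 (ih a w hw).2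
    exact add_mem (add_mem (comm_mem _ (hc x hx) _ hy) (comm_mem _ hx _ (hc y hy)))
      (right a _ (comm_mem x hx y hy))

theorem lieSolvablePower_succ_eq_bot (hF : (2 : F) ≠ 0) (hA : IsNovikov A)
    (hsemi : IsSemiprime F A) {n : ℕ} (hn : lieSolvablePower F A (n + 2) = ⊥) :
    lieSolvablePower F A (n + 1) = ⊥ := by
  have hC := isIdeal_lieSolvablePower hF hA n
  have hD := isIdeal_lieSolvablePower hF hA (n + 1)
  have hcomm : ∀ x ∈ lieSolvablePower F A (n + 1), ∀ y ∈ lieSolvablePower F A (n + 1),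
      x * y = y * x := fun x hx y hy => by
    have h : x * y - y * x ∈ lieSolvablePower F A (n + 2) :=
      Submodule.subset_span ⟨x, hx, y, hy, rfl⟩
    rwa [hn, Submodule.mem_bot, sub_eq_zero] at h
  refine hsemi _ hD fun z hz y hy => ?_
  refine Submodule.span_induction (p := fun z _ => z * y = 0) ?_ (zero_mul y)
    (fun u v _ _ hu hv => by rw [add_mul, hu, hv, add_zero])
    (fun c u _ hu => by rw [smul_mul_assoc, hu, smul_zero]) hz
  rintro _ ⟨c, -, e, -, rfl⟩
  have h := hA.two_smul_commutator_mul (F := F) c e y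
  rw [commute_of_mem_commutative_ideal hA hsemi hD hcomm e (hD c y hy).1,
    commute_of_mem_commutative_ideal hA hsemi hD hcomm c (hD e y hy).1,
    sub_self, sub_self, add_zero] at h
  exact (smul_eq_zero.1 h).resolve_left hF

/-- A Lie-solvable semiprime Novikov algebra is commutative. -/
theorem mul_comm_of_isLieSolvable (hF : (2 : F) ≠ 0) (hA : IsNovikov A)
    (hsemi : IsSemiprime F A) (hsolv : IsLieSolvable F A) (x y : A) : x * y = y * x := by
  obtain ⟨n, hn⟩ := hsolv
  have h₁ : lieSolvablePower F A 1 = ⊥ := by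
    induction n with
    | zero =>
      refine (Submodule.eq_bot_iff _).2 fun z _ => ?_
      have hz : z ∈ lieSolvablePower F A 0 := Submodule.mem_top
      rwa [hn, Submodule.mem_bot] at hz
    | succ n ih =>
      cases n with
      | zero => exact hn
      | succ n => exact ih (lieSolvablePower_succ_eq_bot hF hA hsemi hn)
  have h : x * y - y * x ∈ lieSolvablePower F A 1 :=
    Submodule.subset_span ⟨x, Submodule.mem_top, y, Submodule.mem_top, rfl⟩
  rwa [h₁, Submodule.mem_bot, sub_eq_zero] at h

end Ideals

/-! ### Reduced commutative algebras as subdirect products of domains. -/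

section Commutative

variable {F : Type*} [Field F]

theorem IsNovikov.of_nonUnitalCommRing (A : Type*) [NonUnitalCommRing A] : IsNovikov A where
  left_symm x y z := by simp [associator_apply, mul_assoc, mul_left_comm]
  right_comm x y z := mul_right_comm x y z

theorem IsSemiprime.eq_zero_of_mul_self_eq_zero {A : Type*} [NonUnitalCommRing A] [Module F A]
    [IsScalarTower F A A] [SMulCommClass F A A] (hsemi : IsSemiprime F A) {x : A}
    (hx : x * x = 0) : x = 0 := by
  -- Without a unit, `x` need not lie in `xA`: `xA = 0` only says that `x` annihilates `A`, so the
  -- annihilator lemma is applied with `D = ⊤`.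
  have hbot : LinearMap.range (LinearMap.mulLeft F x) = ⊥ := by
    refine hsemi _ ?_ ?_
    · rintro a _ ⟨b, rfl⟩
      exact ⟨⟨a * b, by simp [mul_left_comm]⟩, ⟨b * a, by simp [mul_assoc]⟩⟩
    · rintro _ ⟨a, rfl⟩ _ ⟨b, rfl⟩
      rw [LinearMap.mulLeft_apply, LinearMap.mulLeft_apply, mul_mul_mul_comm, hx, zero_mul]
  refine eq_zero_of_mul_commutative_ideal_eq_zero (D := (⊤ : Submodule F A))
    (IsNovikov.of_nonUnitalCommRing A) hsemi (fun _ _ _ => ⟨Submodule.mem_top, Submodule.mem_top⟩)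
    (fun x _ y _ => mul_comm x y) Submodule.mem_top fun y _ => ?_
  have hy : x * y ∈ LinearMap.range (LinearMap.mulLeft F x) := ⟨y, rfl⟩
  rwa [hbot, Submodule.mem_bot] at hy

theorem eq_zero_of_isNilpotent_inr {A : Type*} [NonUnitalCommRing A] [Module F A]
    [IsScalarTower F A A] [SMulCommClass F A A] (hred : ∀ x : A, x * x = 0 → x = 0) {x : A}
    (hx : IsNilpotent (Unitization.inr x : Unitization F A)) : x = 0 := by
  have key : ∀ (n : ℕ) (x : A), (Unitization.inr x : Unitization F A) ^ 2 ^ n = 0 → x = 0 := by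
    intro n
    induction n with
    | zero =>
      intro x h
      rw [pow_zero, pow_one] at h
      exact Unitization.inr_injective (h.trans (Unitization.inr_zero F).symm)
    | succ n ih =>
      intro x h
      refine hred x (ih _ ?_)
      rw [Unitization.inr_mul, ← pow_two, ← pow_mul, ← pow_succ']
      exact h
  obtain ⟨n, hn⟩ := hx
  exact key n x (pow_eq_zero_of_le n.lt_two_pow_self.le hn)

/-- A nonzero homomorphism to an integral domain corestricts to a surjection onto an integral domain
in the universe of its source. -/
theorem exists_surjective_of_isDomain {F : Type u} [Field F] {A : Type v}
    [NonUnitalCommRing A] [Module F A] {Q : Type*} [CommRing Q] [IsDomain Q] [Algebra F Q]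
    (ψ : A →ₙₐ[F] Q) {x : A} (hx : ψ x ≠ 0) :
    ∃ (B : Type v) (_ : NonUnitalNonAssocRing B) (_ : Module F B) (_ : IsScalarTower F B B)
      (_ : SMulCommClass F B B) (f : A →ₙₐ[F] B),
      IsIntegralDomain B ∧ Function.Surjective f ∧ f x ≠ 0 := by
  let S : NonUnitalSubalgebra F Q := NonUnitalAlgHom.range ψ
  let g : A → S := fun a => ⟨ψ a, a, rfl⟩
  have hg : Function.Surjective g := by
    rintro ⟨_, a, rfl⟩
    exact ⟨a, rfl⟩
  -- `Q` may live in a larger universe, as quotients of `Unitization F A` do, but the image of `A`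
  -- is small.
  have : Small.{v} S := small_of_surjective hg
  let j : Shrink.{v} S → Q := fun u => ((equivShrink S).symm u : Q)
  have j_inj : Function.Injective j :=
    Subtype.val_injective.comp (equivShrink S).symm.injective
  have j_mul : ∀ u w, j (u * w) = j u * j w := fun u w => by
    simp [j, equivShrink_symm_mul]
  have j_add : ∀ u w, j (u + w) = j u + j w := fun u w => by
    simp [j, equivShrink_symm_add]
  have j_zero : j 0 = 0 := by simp [j, equivShrink_symm_zero]
  have j_smul : ∀ (c : F) u, j (c • u) = c • j u := fun c u => by
    simp [j, equivShrink_symm_smul]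
  have j_g : ∀ a, j (equivShrink S (g a)) = ψ a := fun a => by simp [j, g]
  have ne : equivShrink S (g x) ≠ 0 := fun h => hx (by rw [← j_g, h, j_zero])
  refine ⟨Shrink.{v} S, inferInstance, inferInstance,
    ⟨fun c u w => j_inj ?_⟩, ⟨fun c u w => j_inj ?_⟩,
    { toFun := fun a => equivShrink S (g a)
      map_smul' := fun c a => j_inj ?_
      map_zero' := j_inj ?_
      map_add' := fun a b => j_inj ?_
      map_mul' := fun a b => j_inj ?_ },
    ⟨fun u w t => j_inj ?_, fun u w => j_inj ?_, fun u w h => ?_, ⟨_, ne⟩⟩,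
    (equivShrink S).surjective.comp hg, ne⟩
  · simp only [smul_eq_mul, j_mul, j_smul, smul_mul_assoc]
  · simp only [smul_eq_mul, j_mul, j_smul, mul_smul_comm]
  · simp only [MonoidHom.id_apply, j_g, j_smul, map_smul]
  · rw [j_g, j_zero, map_zero]
  · rw [j_add, j_g, j_g, j_g, map_add]
  · rw [j_mul, j_g, j_g, j_g, map_mul]
  · simp only [j_mul, mul_assoc]
  · simp only [j_mul, mul_comm]
  · have h' : j u * j w = 0 := by rw [← j_mul, h, j_zero]
    exact (mul_eq_zero.1 h').imp (fun h => j_inj (h.trans j_zero.symm))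
      fun h => j_inj (h.trans j_zero.symm)

theorem exists_surjective_isIntegralDomain {F : Type u} [Field F] {A : Type v}
    [NonUnitalCommRing A] [Module F A] [IsScalarTower F A A] [SMulCommClass F A A]
    (hred : ∀ x : A, x * x = 0 → x = 0) {x : A} (hx : x ≠ 0) :
    ∃ (B : Type v) (_ : NonUnitalNonAssocRing B) (_ : Module F B) (_ : IsScalarTower F B B)
      (_ : SMulCommClass F B B) (f : A →ₙₐ[F] B),
      IsIntegralDomain B ∧ Function.Surjective f ∧ f x ≠ 0 := by
  have hnil : (Unitization.inr x : Unitization F A) ∉ nilradical (Unitization F A) :=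
    fun h => hx (eq_zero_of_isNilpotent_inr hred (mem_nilradical.1 h))
  obtain ⟨P, hP, hxP⟩ : ∃ P : Ideal (Unitization F A), P.IsPrime ∧ Unitization.inr x ∉ P := by
    rw [nilradical_eq_sInf, Submodule.mem_sInf] at hnil
    push Not at hnil
    exact hnil
  let π : Unitization F A →ₐ[F] Unitization F A ⧸ P := Ideal.Quotient.mkₐ F P
  exact exists_surjective_of_isDomain
    ((π : Unitization F A →ₙₐ[F] Unitization F A ⧸ P).comp (Unitization.inrNonUnitalAlgHom F A))
    fun h => hxP (Ideal.Quotient.eq_zero_iff_mem.1 h)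

end Commutative

end Novikov

theorem corollary2 {F : Type u} [Field F] (hF : (2 : F) ≠ 0)
    {A : Type v} [NonUnitalNonAssocRing A] [Module F A] [IsScalarTower F A A]
    [SMulCommClass F A A] (hA : Novikov.IsNovikov A)
    (hsemi : Novikov.IsSemiprime F A) (hsolv : Novikov.IsLieSolvable F A) :
    ∃ (ι : Type v) (B : ι → Type v)
      (_ : ∀ i, NonUnitalNonAssocRing (B i)) (_ : ∀ i, Module F (B i))
      (_ : ∀ i, IsScalarTower F (B i) (B i)) (_ : ∀ i, SMulCommClass F (B i) (B i))
      (φ : A →ₙₐ[F] (∀ i, B i)),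
      (∀ i, Novikov.IsIntegralDomain (B i)) ∧ Novikov.IsSubdirect φ := by
  have hcomm := Novikov.mul_comm_of_isLieSolvable hF hA hsemi hsolv
  let _ : NonUnitalCommRing A :=
    { ‹NonUnitalNonAssocRing A› with
      mul_assoc := fun x y z => by rw [hcomm x y, hA.right_comm, hcomm _ x]
      mul_comm := hcomm }
  choose B i₁ i₂ i₃ i₄ f hdom hsurj hne using fun i : {x : A // x ≠ 0} =>
    Novikov.exists_surjective_isIntegralDomain (F := F)
      (fun x hx => hsemi.eq_zero_of_mul_self_eq_zero hx) i.2
  -- One factor for each nonzero `x`, chosen so that `x` survives in it; the family is empty when `A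
  -- = 0`.
  refine ⟨{x : A // x ≠ 0}, B, i₁, i₂, i₃, i₄,
    { toFun := fun a i => f i a
      map_smul' := fun c a => funext fun i => map_smul (f i) c a
      map_zero' := funext fun i => map_zero (f i)
      map_add' := fun a b => funext fun i => map_add (f i) a b
      map_mul' := fun a b => funext fun i => map_mul (f i) a b }, hdom, ?_, hsurj⟩
  intro a b hab
  by_contra h
  refine hne ⟨a - b, sub_ne_zero.2 h⟩ ?_
  rw [map_sub, sub_eq_zero]
  exact congrFun hab ⟨a - b, sub_ne_zero.2 h⟩
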